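/- Let $r\ge 2$ and let $G_1,\dots,G_r$ be connected, locally finite, simple, quasi-transitive graphs (the automorphism group has finitely many orbits on vertices), with vertex sets $V_i$ satisfying $|V_i|\ge 2$ and roots $o_i\in V_i$. Let $\sigma^{(i)}_n$ be the number of $n$-step self-avoiding walks in $G_i$ starting at $o_i$, let $\mathcal M_i(z)=\sum_{n\ge 1}\sigma^{(i)}_n z^n$, and let $R(\mathcal M_i)\in[0,\infty]$ be its radius of convergence. Let $G=G_1*\dots*G_r$ be the free product: its vertices are the finite words (including the empty word $o$, its root) over the disjoint union of the sets $V_i\setminus\{o_i\}$ in which no two consecutive letters come from the same $V_i$; its edges join $wx$ and $wy$ whenever $x,y$ are adjacent in some $G_i$ and $w$ is a word that is empty or whose last letter is not in $V_i$, where $wo_i$ means $w$. Let $\sigma_n$ be the number of $n$-step self-avoiding walks in $G$ starting at $o$. Then there is a smallest real number $z_*>0$ at which all the series $\mathcal M_i(z_*)$ converge and $$\sum_{i=1}^r\frac{\mathcal M_i(z_*)}{1+\mathcal M_i(z_*)}=1 .$$ Moreover $z_*<R(\mathcal M_i)$ for every $i$, and the connective constant $\mu(G)=\lim_{n\to\infty}\sigma_n^{1/n}$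 exists and equals $1/z_*$. -/

import Mathlib

open Filter Topology

/-- A graph is quasi-transitive if its automorphism group acts on the vertices with finitely many
orbits. -/
def IsQuasiTransitive {V : Type*} (G : SimpleGraph V) : Prop :=
  Finite (MulAction.orbitRel.Quotient (G ≃g G) V)

/-- `sawCount G o n` is the number `σ_n` of `n`-step self-avoiding walks in `G` starting at `o`,
that is, of walks of length `n` from `o` (to an arbitrary endpoint) that visit no vertex twice. -/
noncomputable def sawCount {V : Type*} (G : SimpleGraph V) (o : V) (n : ℕ) : ℕ :=
  Nat.card {p : Σ v : V, G.Walk o v // p.2.IsPath ∧ p.2.length = n}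

/-- `μ` is the connective constant of the graph `G` rooted at `o`: the limit of `σ_n ^ (1 / n)`
exists and equals `μ`. -/
def IsConnectiveConstant {V : Type*} (G : SimpleGraph V) (o : V) (μ : ℝ) : Prop :=
  Tendsto (fun n : ℕ => (sawCount G o n : ℝ) ^ (1 / (n : ℝ))) atTop (𝓝 μ)

/-- The coefficients of `M(z) = ∑_{n ≥ 1} σ_n z ^ n`; the constant coefficient is `0`. -/
noncomputable def sawCoeff {V : Type*} (G : SimpleGraph V) (o : V) (n : ℕ) : ℝ :=
  if n = 0 then 0 else (sawCount G o n : ℝ)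

/-- The value of the generating function `M(z) = ∑_{n ≥ 1} σ_n z ^ n` at a real point `z`. -/
noncomputable def sawGF {V : Type*} (G : SimpleGraph V) (o : V) (z : ℝ) : ℝ :=
  ∑' n : ℕ, sawCoeff G o n * z ^ n

/-- The radius of convergence `R(M)`, in `[0, ∞]`, of `M(z) = ∑_{n ≥ 1} σ_n z ^ n`. -/
noncomputable def sawRadius {V : Type*} (G : SimpleGraph V) (o : V) : ENNReal :=
  (FormalMultilinearSeries.ofScalars ℝ (sawCoeff G o)).radius

section FreeProduct

variable {ι : Type*} {V : ι → Type*}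

/-- The vertices of the free product of the rooted vertex sets `(V i, o i)`: the words over the
disjoint union of the sets `V i \ {o i}` in which no two consecutive letters come from the same
`V i`, including the empty word. -/
@[ext]
structure FreeProductVertex (o : ∀ i, V i) where
  /-- The letters of the word. -/
  letters : List (Σ i, V i)
  /-- No letter is a root. -/
  ne_root : ∀ l ∈ letters, l.2 ≠ o l.1
  /-- Consecutive letters come from different factors. -/
  alternating : letters.IsChain (fun l l' => l.1 ≠ l'.1)

namespace FreeProductVertex

variable {o : ∀ i, V i}

/-- The empty word, which is the root of the free product. -/
def root (o : ∀ i, V i) : FreeProductVertex o where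
  letters := []
  ne_root := by simp
  alternating := by simp

/-- The type `τ(w)` of a word: the index of the factor that contains its last letter, and `none`
for the empty word. -/
def type (w : FreeProductVertex o) : Option ι :=
  w.letters.getLast?.map Sigma.fst

open Classical in
/-- An element `x` of `V i` seen as a word: one letter if `x ≠ o i`, the empty word if
`x = o i`. -/
noncomputable def letterWord (o : ∀ i, V i) (i : ι) (x : V i) : List (Σ i, V i) :=
  if x = o i then [] else [⟨i, x⟩]

theorem letterWord_injective (i : ι) : Function.Injective (letterWord o i) := by
  intro x y h
  unfold letterWord at h
  split_ifs at h with hx hy hy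
  · rw [hx, hy]
  · simpa using h

end FreeProductVertex

/-- The free product of the rooted graphs `(G i, o i)`: two vertices are adjacent exactly if they
are of the form `w x` and `w y` with `x`, `y` adjacent in some `G i` and `τ(w) ≠ i`, where
`w (o i)` stands for `w`. -/
def freeProduct (G : ∀ i, SimpleGraph (V i)) (o : ∀ i, V i) :
    SimpleGraph (FreeProductVertex o) where
  Adj u v := ∃ (w : FreeProductVertex o) (i : ι) (x y : V i),
    w.type ≠ some i ∧ (G i).Adj x y ∧
      u.letters = w.letters ++ FreeProductVertex.letterWord o i x ∧
      v.letters = w.letters ++ FreeProductVertex.letterWord o i y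
  symm := ⟨fun _ _ ⟨w, i, x, y, hw, hxy, hu, hv⟩ => ⟨w, i, y, x, hw, hxy.symm, hv, hu⟩⟩
  loopless := ⟨fun _ ⟨_, i, _, _, _, hxy, hu, hv⟩ => hxy.ne
    (FreeProductVertex.letterWord_injective i (List.append_cancel_left (hu.symm.trans hv)))⟩

end FreeProduct

/-! The copies of the factors in the free product are glued in a tree-like way at cut vertices. A
self-avoiding walk from the root enters a copy at its base vertex and, once it leaves for a deeper
copy, cannot come back. Hence it is uniquely a concatenation of nonempty self-avoiding walks in the
factors, each from `o i`, with consecutive ones in different factors (`exists_equiv_sawSetOfType`).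
If `S` is the generating function of all walks and `E_i` that of the walks whose endpoint has type
`i`, then `E_i = (S - E_i) M_i` and `S = 1 + ∑ E_i`, so formally `S = 1 / (1 - ∑ M_i / (1 + M_i))`,
and `z_*` is where the denominator vanishes.

The growth rate is read off from the coefficients, without singularity analysis: the weights `v_i =
M_i / (1 + M_i)` at `z_*` sum to `1` and satisfy `v_i = (1 - v_i) M_i`, so bounds proportional to
`v_i` propagate through the recursion (`upper_bound`; `lower_bound` uses truncated series at points
beyond `z_*`).

That `z_*` exists inside all the discs of convergence uses quasi-transitivity: counts summed over
orbits are submultiplicative, so each `M_i` converges on an open set of positive reals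
(`sawCount_bound_of_summable`). If the sum stayed below `1`, all the `M_i` would be bounded, hence
convergent at the end of the common interval of convergence and therefore beyond it
(`exists_sum_powerSum_eq_one`). -/

open Finset.HasAntidiagonal (antidiagonal mem_antidiagonal)

/-! ### Self-avoiding walks as vertex lists, and inequalities between their numbers. -/

section SelfAvoidingLists

variable {V : Type*} {G : SimpleGraph V}

/-- The `n`-step self-avoiding walks starting at `o`, as lists of vertices in reverse order: the
head of the list is the endpoint and its last entry is `o`. -/
def sawSet (G : SimpleGraph V) (o : V) (n : ℕ) : Set (List V) :=
  {l | l.IsChain G.Adj ∧ l.Nodup ∧ l.getLast? = some o ∧ l.length = n + 1}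

theorem walk_support_mem_sawSet {u o : V} (p : G.Walk u o) (hp : p.IsPath) :
    p.support ∈ sawSet G o p.length := by
  refine ⟨p.isChain_adj_support, hp.support_nodup, ?_, p.length_support⟩
  rw [List.getLast?_eq_getLast_of_ne_nil p.support_ne_nil, p.getLast_support]

theorem exists_walk_of_mem_sawSet {o : V} : ∀ {n : ℕ} {l : List V}, l ∈ sawSet G o n →
    ∃ (u : V) (p : G.Walk u o), p.IsPath ∧ p.length = n ∧ p.support = l := by
  intro n l
  induction l generalizing n with
  | nil => intro h; simp [sawSet] at h
  | cons u l ih =>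
    rintro ⟨hc, hn, hl, hlen⟩
    cases l with
    | nil =>
      simp only [List.getLast?_singleton, Option.some.injEq] at hl
      subst hl
      refine ⟨u, SimpleGraph.Walk.nil, by simp, ?_, by simp⟩
      rw [SimpleGraph.Walk.length_nil]
      simp at hlen
      omega
    | cons v l =>
      obtain ⟨n, rfl⟩ : ∃ m, n = m + 1 := ⟨l.length, by simpa using hlen.symm⟩
      rw [List.isChain_cons_cons] at hc
      rw [List.nodup_cons] at hn
      obtain ⟨w, p, hp, hpl, hps⟩ := ih (n := n)
        ⟨hc.2, hn.2, by simpa using hl, by simpa using hlen⟩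
      obtain rfl : w = v := by
        have := p.head_support
        simp only [hps, List.head_cons] at this
        exact this.symm
      refine ⟨u, SimpleGraph.Walk.cons hc.1 p, ?_, by simp [hpl], by simp [hps]⟩
      rw [SimpleGraph.Walk.cons_isPath_iff]
      exact ⟨hp, by rw [hps]; exact hn.1⟩

theorem sawCount_eq_ncard (G : SimpleGraph V) (o : V) (n : ℕ) :
    sawCount G o n = (sawSet G o n).ncard := by
  unfold sawCount
  rw [← Nat.card_coe_set_eq]
  refine Nat.card_eq_of_bijective
    (fun p => ⟨p.1.2.reverse.support, ?_⟩) ⟨?_, ?_⟩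
  · have := walk_support_mem_sawSet p.1.2.reverse (p.1.2.isPath_reverse_iff.2 p.2.1)
    rwa [SimpleGraph.Walk.length_reverse, p.2.2] at this
  · rintro ⟨⟨u, p⟩, hp⟩ ⟨⟨v, q⟩, hq⟩ h
    have h' : p.reverse.support = q.reverse.support := congrArg Subtype.val h
    obtain rfl : u = v := by
      rw [← p.reverse.head_support, ← q.reverse.head_support]
      simp only [h']
    have h2 := SimpleGraph.Walk.ext_support h'
    have h3 := congrArg SimpleGraph.Walk.reverse h2
    simp only [SimpleGraph.Walk.reverse_reverse] at h3
    simp only [h3]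
  · rintro ⟨l, hl⟩
    obtain ⟨u, p, hp, hpl, hps⟩ := exists_walk_of_mem_sawSet hl
    exact ⟨⟨⟨u, p.reverse⟩, p.isPath_reverse_iff.2 hp, by simpa using hpl⟩, by simp [hps]⟩

theorem sawSet_zero (o : V) : sawSet G o 0 = {[o]} := by
  ext l
  constructor
  · rintro ⟨-, -, hl, hlen⟩
    obtain ⟨a, rfl⟩ := List.length_eq_one_iff.1 hlen
    simpa using hl
  · rintro rfl
    simp [sawSet]

theorem sawSet_nonempty_one [Nontrivial V] (hG : G.Connected) (o : V) :
    (sawSet G o 1).Nonempty := by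
  obtain ⟨u, hu⟩ := hG.preconnected.exists_adj_of_nontrivial o
  exact ⟨[u, o], by simp [sawSet, hu.symm, hu.ne']⟩

theorem sawSet_finite (hG : ∀ v, (G.neighborSet v).Finite) (o : V) (n : ℕ) :
    (sawSet G o n).Finite := by
  induction n with
  | zero => rw [sawSet_zero]; exact Set.finite_singleton _
  | succ n ih =>
    refine (ih.biUnion fun l _ => (l.finite_toSet).biUnion fun v _ =>
      (hG v).image (fun u => u :: l)).subset ?_
    rintro l ⟨hc, hn, hl, hlen⟩
    match l, hc, hn, hl, hlen with
    | u :: v :: l, hc, hn, hl, hlen =>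
      rw [List.isChain_cons_cons] at hc
      simp only [Set.mem_iUnion]
      exact ⟨v :: l, ⟨hc.2, (List.nodup_cons.1 hn).2, by simpa using hl, by simpa using hlen⟩,
        v, by simp, u, hc.1.symm, rfl⟩

theorem sawCount_le_of_iso (hG : ∀ v, (G.neighborSet v).Finite) (φ : G ≃g G) (o : V) (n : ℕ) :
    sawCount G o n ≤ sawCount G (φ o) n := by
  rw [sawCount_eq_ncard, sawCount_eq_ncard]
  refine Set.ncard_le_ncard_of_injOn (List.map φ) ?_ (φ.injective.list_map.injOn)
    (sawSet_finite hG _ _)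
  rintro l ⟨hc, hn, hl, hlen⟩
  refine ⟨?_, hn.map φ.injective, by simp [hl], by simpa using hlen⟩
  exact List.isChain_map_of_isChain φ (fun _ _ => φ.map_adj_iff.2) hc

/-- Cut the walk at the vertex reached after `m` steps. Lists run backwards, so `drop n` is the
initial piece and `take (n + 1)` the final one; `dropLast` removes the shared vertex. -/
theorem sawCount_add_le (hG : ∀ v, (G.neighborSet v).Finite) {n B : ℕ}
    (hB : ∀ u, sawCount G u n ≤ B) (v : V) (m : ℕ) :
    sawCount G v (m + n) ≤ sawCount G v m * B := by
  classical
  let F : V → ℕ → Finset (List V) := fun o k => (sawSet_finite hG o k).toFinset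
  have hF : ∀ o k, sawCount G o k = (F o k).card := fun o k => by
    rw [sawCount_eq_ncard, Set.ncard_eq_toFinset_card _ (sawSet_finite hG o k)]
  have hsub : F v (m + n) ⊆ (F v m).biUnion fun l =>
      (F (l.headD v) n).image fun k => k.dropLast ++ l := by
    intro l hl
    obtain ⟨hc, hn, hlast, hlen⟩ : l ∈ sawSet G v (m + n) := by simpa [F] using hl
    have hlt : n < l.length := by omega
    have hdrop : l.drop n = l[n] :: l.drop (n + 1) := List.drop_eq_getElem_cons hlt
    simp only [Finset.mem_biUnion, Finset.mem_image, F, Set.Finite.mem_toFinset]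
    refine ⟨l.drop n, ⟨hc.drop n, hn.sublist (List.drop_sublist _ _), ?_, ?_⟩,
      l.take (n + 1), ⟨hc.take _, hn.sublist (List.take_sublist _ _), ?_, ?_⟩, ?_⟩
    · rw [List.getLast?_drop, if_neg (by omega), hlast]
    · rw [List.length_drop]; omega
    · rw [hdrop, List.headD_cons, List.take_succ_eq_append_getElem hlt, List.getLast?_concat]
    · rw [List.length_take]; omega
    · rw [List.take_succ_eq_append_getElem hlt, List.dropLast_concat, List.take_append_drop]
  rw [hF, hF]
  refine (Finset.card_le_card hsub).trans (Finset.card_biUnion_le_card_mul _ _ _ fun l _ => ?_)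
  exact Finset.card_image_le.trans ((hF _ _).symm.le.trans (hB _))

/-- A walk from `u` that avoids `v` becomes a longer walk from `v` by adding the step from `v` to
`u`. One that visits `v` splits there into two walks from `v`, one of them traversed backwards. -/
theorem sawCount_le_of_adj (hG : ∀ v, (G.neighborSet v).Finite) {u v : V} (huv : G.Adj u v)
    (n : ℕ) : sawCount G u n ≤ sawCount G v (n + 1) +
      ∑ ab ∈ antidiagonal n, sawCount G v ab.1 * sawCount G v ab.2 := by
  classical
  let F : V → ℕ → Finset (List V) := fun o k => (sawSet_finite hG o k).toFinset
  have hF : ∀ o k, sawCount G o k = (F o k).card := fun o k => by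
    rw [sawCount_eq_ncard, Set.ncard_eq_toFinset_card _ (sawSet_finite hG o k)]
  have hsub : F u n ⊆ (F v (n + 1)).image List.dropLast ∪ (antidiagonal n).biUnion
      fun ab => Finset.image₂ (fun k l => k.dropLast ++ l.reverse) (F v ab.1) (F v ab.2) := by
    intro l hl
    obtain ⟨hc, hn, hlast, hlen⟩ : l ∈ sawSet G u n := by simpa [F] using hl
    simp only [Finset.mem_union, Finset.mem_biUnion, Finset.mem_image, Finset.mem_image₂, F,
      Set.Finite.mem_toFinset, mem_antidiagonal]
    by_cases hv : v ∈ l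
    · right
      obtain ⟨l₁, l₂, rfl⟩ := List.append_of_mem hv
      have hc' := List.isChain_split.1 hc
      refine ⟨(l₁.length, l₂.length), ?_, l₁ ++ [v], ⟨hc'.1, ?_, by simp, by simp⟩,
        (v :: l₂).reverse, ⟨?_, ?_, ?_, by simp⟩, by simp⟩
      · simp at hlen ⊢; omega
      · exact hn.sublist (by simp)
      · rw [List.isChain_reverse]
        exact hc'.2.imp fun _ _ h => h.symm
      · rw [List.nodup_reverse]; exact hn.sublist (by simp)
      · simp
    · left
      refine ⟨l ++ [v], ⟨?_, ?_, by simp, by simpa using hlen⟩, by simp⟩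
      · rw [List.isChain_append]
        refine ⟨hc, by simp, ?_⟩
        rw [hlast]
        simpa using huv
      · rw [List.nodup_append]
        refine ⟨hn, by simp, ?_⟩
        rintro a ha b hb rfl
        simp only [List.mem_singleton] at hb
        exact hv (hb ▸ ha)
  simp only [hF]
  refine (Finset.card_le_card hsub).trans ((Finset.card_union_le _ _).trans
    (add_le_add Finset.card_image_le (Finset.card_biUnion_le.trans
      (Finset.sum_le_sum fun ab _ => Finset.card_image₂_le _ _ _))))

end SelfAvoidingLists

/-! ### Submultiplicativity over orbits, and openness of the set of convergence. -/

section QuasiTransitive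

variable {V : Type*} {G : SimpleGraph V}

/-- The sum of the numbers of `n`-step self-avoiding walks over representatives of the orbits of the
automorphism group. -/
noncomputable def orbitSawCount (G : SimpleGraph V)
    [Fintype (MulAction.orbitRel.Quotient (G ≃g G) V)] (n : ℕ) : ℕ :=
  ∑ q : MulAction.orbitRel.Quotient (G ≃g G) V, sawCount G q.out n

theorem sawCount_le_orbitSawCount [Fintype (MulAction.orbitRel.Quotient (G ≃g G) V)]
    (hG : ∀ v, (G.neighborSet v).Finite) (o : V) (n : ℕ) :
    sawCount G o n ≤ orbitSawCount G n := by
  let q : MulAction.orbitRel.Quotient (G ≃g G) V := Quotient.mk _ o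
  have hq : MulAction.orbitRel (G ≃g G) V q.out o := Quotient.mk_out (s := _) o
  rw [MulAction.orbitRel_apply] at hq
  obtain ⟨φ, hφ⟩ := hq
  calc sawCount G o n ≤ sawCount G (φ o) n := sawCount_le_of_iso hG φ o n
    _ = sawCount G q.out n := by rw [← hφ]; rfl
    _ ≤ _ := Finset.single_le_sum (f := fun q : MulAction.orbitRel.Quotient (G ≃g G) V =>
        sawCount G q.out n) (fun _ _ => Nat.zero_le _) (Finset.mem_univ q)

/-- The second half of a walk may start in any orbit; the sum over all orbits dominates it wherever
it starts. -/
theorem orbitSawCount_add_le [Fintype (MulAction.orbitRel.Quotient (G ≃g G) V)]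
    (hG : ∀ v, (G.neighborSet v).Finite) (m n : ℕ) :
    orbitSawCount G (m + n) ≤ orbitSawCount G m * orbitSawCount G n := by
  rw [orbitSawCount, orbitSawCount, Finset.sum_mul]
  exact Finset.sum_le_sum fun q _ =>
    sawCount_add_le hG (fun u => sawCount_le_orbitSawCount hG u n) _ m

/-- A submultiplicative sequence whose `n`-th term is below `t ^ (-n)` grows at most like
`t ^ (-m)`. -/
theorem exists_bound_of_submultiplicative {c : ℕ → ℝ} (h0 : ∀ n, 0 ≤ c n)
    (hc : ∀ m n, c (m + n) ≤ c m * c n) {t : ℝ} (ht : 0 ≤ t) {n : ℕ} (hn : n ≠ 0)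
    (hnt : c n * t ^ n ≤ 1) : ∃ B, ∀ m, c m * t ^ m ≤ B := by
  -- Removing blocks of length `n`, each costing a factor at most `1`, reduces `m` to its residue
  -- mod `n`; the sum bounds all residues at once.
  refine ⟨∑ j ∈ Finset.range n, c j * t ^ j, fun m => ?_⟩
  have key : ∀ k j, c (j + n * k) * t ^ (j + n * k) ≤ c j * t ^ j := by
    intro k j
    induction k with
    | zero => simp
    | succ k ih =>
      have e : j + n * (k + 1) = (j + n * k) + n := by ring
      rw [e]
      calc c (j + n * k + n) * t ^ (j + n * k + n)
          ≤ (c (j + n * k) * c n) * t ^ (j + n * k + n) := by gcongr; exact hc _ _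
        _ = (c (j + n * k) * t ^ (j + n * k)) * (c n * t ^ n) := by ring
        _ ≤ (c (j + n * k) * t ^ (j + n * k)) * 1 :=
            mul_le_mul_of_nonneg_left hnt (mul_nonneg (h0 _) (pow_nonneg ht _))
        _ ≤ _ := by rw [mul_one]; exact ih
  rw [← Nat.mod_add_div m n]
  refine (key _ _).trans (Finset.single_le_sum (f := fun j => c j * t ^ j)
    (fun j _ => mul_nonneg (h0 j) (pow_nonneg ht j)) ?_)
  exact Finset.mem_range.2 (Nat.mod_lt _ (Nat.pos_of_ne_zero hn))

/-- By `sawCount_le_of_adj` the series at `u` is dominated by a shift of the series at `v`, divided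
by `z`, plus its Cauchy square. -/
theorem summable_sawCount_of_adj (hG : ∀ v, (G.neighborSet v).Finite) {u v : V}
    (huv : G.Adj u v) {z : ℝ} (hz : 0 < z) (h : Summable fun n => (sawCount G v n : ℝ) * z ^ n) :
    Summable fun n => (sawCount G u n : ℝ) * z ^ n := by
  have h1 : Summable fun n => z⁻¹ * ((sawCount G v (n + 1) : ℝ) * z ^ (n + 1)) :=
    ((summable_nat_add_iff 1).2 h).mul_left _
  have h2 := (summable_norm_sum_mul_antidiagonal_of_summable_norm h.norm h.norm).of_norm
  refine Summable.of_nonneg_of_le (fun n => by positivity) (fun n => ?_) (h1.add h2)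
  have h3 : (sawCount G u n : ℝ) ≤ sawCount G v (n + 1) +
      ∑ ab ∈ antidiagonal n, (sawCount G v ab.1 : ℝ) * sawCount G v ab.2 := by
    exact_mod_cast sawCount_le_of_adj hG huv n
  calc (sawCount G u n : ℝ) * z ^ n
      ≤ (sawCount G v (n + 1) +
      ∑ ab ∈ antidiagonal n, (sawCount G v ab.1 : ℝ) * sawCount G v ab.2) * z ^ n := by
        gcongr
    _ = _ := by
      rw [add_mul, Finset.sum_mul]
      congr 1
      · field_simp
        ring
      · refine Finset.sum_congr rfl fun ab hab => ?_
        rw [← mem_antidiagonal.1 hab, pow_add]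
        ring

theorem summable_sawCount_of_connected (hG : ∀ v, (G.neighborSet v).Finite) (hconn : G.Connected)
    {u v : V} {z : ℝ} (hz : 0 < z) (h : Summable fun n => (sawCount G v n : ℝ) * z ^ n) :
    Summable fun n => (sawCount G u n : ℝ) * z ^ n := by
  obtain ⟨p⟩ := hconn.preconnected u v
  induction p with
  | nil => exact h
  | cons huv _ ih => exact summable_sawCount_of_adj hG huv hz (ih h)

theorem sawCount_bound_near_zero (hG : ∀ v, (G.neighborSet v).Finite) (hqt : IsQuasiTransitive G)
    (o : V) : ∃ t : ℝ, 0 < t ∧ ∃ B : ℝ, ∀ n, (sawCount G o n : ℝ) * t ^ n ≤ B := by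
  have := hqt
  unfold IsQuasiTransitive at this
  have := Fintype.ofFinite (MulAction.orbitRel.Quotient (G ≃g G) V)
  have hpos : (0 : ℝ) < 1 / (orbitSawCount G 1 + 1) := by positivity
  obtain ⟨B, hB⟩ := exists_bound_of_submultiplicative (c := fun n => (orbitSawCount G n : ℝ))
    (fun _ => by positivity) (fun m n => by exact_mod_cast orbitSawCount_add_le hG m n)
    hpos.le one_ne_zero (by rw [pow_one, mul_one_div, div_le_one (by positivity)]; linarith)
  refine ⟨_, hpos, B, fun n => le_trans ?_ (hB n)⟩
  gcongr
  exact sawCount_le_orbitSawCount hG o n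

/-- The set of positive reals at which the generating function of self-avoiding walks of a
quasi-transitive graph converges is open. -/
theorem sawCount_bound_of_summable (hG : ∀ v, (G.neighborSet v).Finite) (hconn : G.Connected)
    (hqt : IsQuasiTransitive G) {o : V} {z : ℝ} (hz : 0 < z)
    (h : Summable fun n => (sawCount G o n : ℝ) * z ^ n) :
    ∃ t : ℝ, z < t ∧ ∃ B : ℝ, ∀ n, (sawCount G o n : ℝ) * t ^ n ≤ B := by
  have := hqt
  unfold IsQuasiTransitive at this
  have := Fintype.ofFinite (MulAction.orbitRel.Quotient (G ≃g G) V)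
  have hs : Summable fun n => (orbitSawCount G n : ℝ) * z ^ n := by
    simp only [orbitSawCount, Nat.cast_sum, Finset.sum_mul]
    exact summable_sum fun q _ => summable_sawCount_of_connected hG hconn hz h
  -- Convergence makes some term smaller than `1`; by continuity this one strict inequality survives
  -- slightly to the right of `z`, and submultiplicativity turns it into a bound on all terms.
  obtain ⟨n, hn, hn0⟩ := ((hs.tendsto_atTop_zero.eventually_lt_const one_pos).and
    (eventually_ne_atTop 0)).exists
  have hcont : Tendsto (fun t : ℝ => (orbitSawCount G n : ℝ) * t ^ n) (𝓝[>] z)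
      (𝓝 ((orbitSawCount G n : ℝ) * z ^ n)) :=
    ((continuous_const.mul (continuous_pow n)).tendsto z).mono_left nhdsWithin_le_nhds
  obtain ⟨t, ht, hzt⟩ := ((hcont.eventually_lt_const hn).and self_mem_nhdsWithin).exists
  have hzt : z < t := hzt
  obtain ⟨B, hB⟩ := exists_bound_of_submultiplicative (c := fun n => (orbitSawCount G n : ℝ))
    (fun _ => by positivity) (fun m n => by exact_mod_cast orbitSawCount_add_le hG m n)
    (hz.trans hzt).le hn0 ht.le
  have := hz.trans hzt
  refine ⟨t, hzt, B, fun n => le_trans ?_ (hB n)⟩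
  gcongr
  exact sawCount_le_orbitSawCount hG o n

end QuasiTransitive

/-! ### Unique decomposition of walks in the free product. -/

section FreeProductWalks

variable {ι : Type*} {V : ι → Type*} {o : ∀ i, V i} {G : ∀ i, SimpleGraph (V i)}

namespace FreeProductVertex

theorem letterWord_root (i : ι) : letterWord o i (o i) = [] := if_pos rfl

theorem letterWord_of_ne {i : ι} {x : V i} (hx : x ≠ o i) : letterWord o i x = [⟨i, x⟩] :=
  if_neg hx

open Classical in
/-- The word `w x`, for a word `w` that does not end with a letter of type `i` and `x` in `V i`. -/
noncomputable def append (w : FreeProductVertex o) (i : ι) (x : V i) : FreeProductVertex o :=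
  if h : w.type ≠ some i ∧ x ≠ o i then
    { letters := w.letters ++ [⟨i, x⟩]
      ne_root := by
        intro l hl
        rcases List.mem_append.1 hl with hl | hl
        · exact w.ne_root l hl
        · rw [List.mem_singleton.1 hl]; exact h.2
      alternating := by
        rw [List.isChain_append]
        refine ⟨w.alternating, by simp, fun a ha b hb hab => h.1 ?_⟩
        simp only [List.head?_cons, Option.mem_def, Option.some.injEq] at hb
        rw [Option.mem_def] at ha
        subst hb
        simp [type, ha, hab] }
  -- This covers the intended case `x = o i`, and is a default value when `w` already ends with a
  -- letter of type `i`.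
  else w

theorem append_root (w : FreeProductVertex o) (i : ι) : w.append i (o i) = w :=
  dif_neg fun h => h.2 rfl

theorem letters_append_of_ne {w : FreeProductVertex o} {i : ι} (hw : w.type ≠ some i) {x : V i}
    (hx : x ≠ o i) : (w.append i x).letters = w.letters ++ [⟨i, x⟩] := by
  unfold append
  rw [dif_pos ⟨hw, hx⟩]

theorem letters_append {w : FreeProductVertex o} {i : ι} (hw : w.type ≠ some i) (x : V i) :
    (w.append i x).letters = w.letters ++ letterWord o i x := by
  by_cases hx : x = o i
  · subst hx; rw [append_root, letterWord_root, List.append_nil]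
  · rw [letters_append_of_ne hw hx, letterWord_of_ne hx]

theorem append_injective {w : FreeProductVertex o} {i : ι} (hw : w.type ≠ some i) :
    Function.Injective (w.append i) := fun x y h => by
  have := congrArg letters h
  rw [letters_append hw, letters_append hw] at this
  exact letterWord_injective i (List.append_cancel_left this)

theorem type_append {w : FreeProductVertex o} {i : ι} (hw : w.type ≠ some i) {x : V i}
    (hx : x ≠ o i) : (w.append i x).type = some i := by
  simp [type, letters_append_of_ne hw hx]

theorem eq_of_append_eq_append {w w' : FreeProductVertex o} {i j : ι} (hw : w.type ≠ some i)
    (hw' : w'.type ≠ some j) {x : V i} {y : V j} (hx : x ≠ o i) (hy : y ≠ o j)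
    (h : w.append i x = w'.append j y) : w = w' ∧ (⟨i, x⟩ : Σ i, V i) = ⟨j, y⟩ := by
  have := congrArg letters h
  rw [letters_append_of_ne hw hx, letters_append_of_ne hw' hy] at this
  obtain ⟨h1, h2⟩ := List.append_inj' this rfl
  exact ⟨FreeProductVertex.ext h1, by simpa using h2⟩

theorem type_root : (root o).type = none := rfl

end FreeProductVertex

open FreeProductVertex

theorem freeProduct_adj_append {w : FreeProductVertex o} {i : ι} (hw : w.type ≠ some i)
    {x y : V i} (h : (G i).Adj x y) : (freeProduct G o).Adj (w.append i x) (w.append i y) :=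
  ⟨w, i, x, y, hw, h, letters_append hw x, letters_append hw y⟩

theorem exists_append_of_freeProduct_adj {u v : FreeProductVertex o}
    (h : (freeProduct G o).Adj u v) : ∃ (w : FreeProductVertex o) (i : ι) (x y : V i),
      w.type ≠ some i ∧ (G i).Adj x y ∧ u = w.append i x ∧ v = w.append i y := by
  obtain ⟨w, i, x, y, hw, hxy, hu, hv⟩ := h
  exact ⟨w, i, x, y, hw, hxy, FreeProductVertex.ext (by rw [hu, letters_append hw]),
    FreeProductVertex.ext (by rw [hv, letters_append hw])⟩

theorem exists_eq_append_of_mem_sawSet {V : Type*} {G : SimpleGraph V} {o : V} {n : ℕ} {q : List V}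
    (hq : q ∈ sawSet G o n) : ∃ p : List V, q = p ++ [o] ∧ p.IsChain G.Adj ∧ p.Nodup ∧ o ∉ p ∧
      p.length = n ∧ ∀ x ∈ p.getLast?, G.Adj x o := by
  obtain ⟨hc, hn, hl, hlen⟩ := hq
  obtain ⟨p, rfl⟩ := List.getLast?_eq_some_iff.1 hl
  rw [List.isChain_append] at hc
  rw [List.nodup_append] at hn
  refine ⟨p, rfl, hc.1, hn.1, fun h => hn.2.2 o h o (by simp) rfl, by simpa using hlen, ?_⟩
  exact fun x hx => hc.2.2 x hx o (by simp)

theorem exists_eq_cons_of_mem_sawSet {V : Type*} {G : SimpleGraph V} {o : V} {n : ℕ} {l : List V}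
    (hl : l ∈ sawSet G o n) (d : V) : ∃ t, l = l.headD d :: t := by
  obtain ⟨-, -, -, hlen⟩ := hl
  match l, hlen with
  | a :: t, _ => exact ⟨t, rfl⟩

/-- The endpoint of a self-avoiding walk in the free product that starts at the root. -/
def endpoint (l : List (FreeProductVertex o)) : FreeProductVertex o := l.headD (root o)

/-- The continuation of a walk `l` in the free product by the copy of a walk `q` in the
factor `j`, both given in reverse order. -/
noncomputable def glue (j : ι) (l : List (FreeProductVertex o)) (q : List (V j)) :
    List (FreeProductVertex o) :=
  -- The last entry of `q` is `o j`, whose copy is the endpoint already present in `l`.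
  q.dropLast.map ((endpoint l).append j) ++ l

theorem glue_concat (j : ι) (l : List (FreeProductVertex o)) (p : List (V j)) (x : V j) :
    glue j l (p ++ [x]) = p.map ((endpoint l).append j) ++ l := by
  rw [glue, List.dropLast_concat]

theorem endpoint_glue {j : ι} {l : List (FreeProductVertex o)} {q : List (V j)} {n : ℕ}
    (hq : q ∈ sawSet (G j) (o j) n) (hn : n ≠ 0) :
    ∃ x ≠ o j, x = q.headD (o j) ∧ endpoint (glue j l q) = (endpoint l).append j x := by
  obtain ⟨p, rfl, -, -, hop, hlen, -⟩ := exists_eq_append_of_mem_sawSet hq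
  match p, hlen, hop with
  | [], hlen, _ => exact absurd hlen.symm hn
  | x :: p, _, hop =>
    exact ⟨x, fun h => hop (by simp [h]), by simp, by rw [glue_concat]; rfl⟩

/-- Induction on the final step, an edge from `w y` to `w x` in a copy of the factor `i`: it either
opens a new block or extends the last one. -/
theorem exists_glue_of_mem_sawSet {l : List (FreeProductVertex o)} : ∀ {n : ℕ},
    l ∈ sawSet (freeProduct G o) (root o) n → n = 0 ∧ l = [root o] ∨
      ∃ (j : ι) (a b : ℕ) (l' : List (FreeProductVertex o)) (q : List (V j)), a + b = n ∧ b ≠ 0 ∧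
        l' ∈ sawSet (freeProduct G o) (root o) a ∧ (endpoint l').type ≠ some j ∧
        q ∈ sawSet (G j) (o j) b ∧ l = glue j l' q := by
  induction l with
  | nil => rintro n ⟨-, -, h, -⟩; simp at h
  | cons u l ih =>
    rintro n ⟨hc, hn, hlast, hlen⟩
    cases l with
    | nil =>
      left
      simp only [List.getLast?_singleton, Option.some.injEq] at hlast
      simp only [List.length_singleton] at hlen
      exact ⟨by omega, by rw [hlast]⟩
    | cons v l =>
      right
      obtain ⟨n, rfl⟩ : ∃ m, n = m + 1 := ⟨l.length, by simpa using hlen.symm⟩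
      rw [List.isChain_cons_cons] at hc
      rw [List.nodup_cons] at hn
      have hl : v :: l ∈ sawSet (freeProduct G o) (root o) n :=
        ⟨hc.2, hn.2, by simpa using hlast, by simpa using hlen⟩
      obtain ⟨w, i, x, y, hw, hxy, rfl, rfl⟩ := exists_append_of_freeProduct_adj hc.1
      -- If `y = o i`, the step leaves the base vertex `w`, and so forms a new block of length `1`.
      by_cases hy : y = o i
      · subst hy
        have he : endpoint (w.append i (o i) :: l) = w := append_root w i
        refine ⟨i, n, 1, _, [x, o i], rfl, one_ne_zero, hl, ?_, ?_, ?_⟩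
        · rwa [he]
        · simp [sawSet, hxy, hxy.ne]
        · have := glue_concat i (w.append i (o i) :: l) [x] (o i)
          rw [he] at this
          exact this.symm
      · rcases ih hl with ⟨-, h⟩ | ⟨j, a, b, l', q, hab, hb, hl', hj, hq, h⟩
        · have h1 : w.append i y = root o := congrArg endpoint h
          have := type_append hw hy
          rw [h1, type_root] at this
          cases this
        -- Unique reading of the word `w y` shows that the last block lies in the same copy, so `x`
        -- prolongs it.
        · obtain ⟨z, hz, hzq, he⟩ := endpoint_glue (l := l') hq hb
          rw [← h] at he
          obtain ⟨h1, h2⟩ := eq_of_append_eq_append hw hj hy hz he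
          obtain ⟨rfl, h2⟩ := Sigma.mk.inj_iff.1 h2
          obtain rfl := eq_of_heq h2
          subst h1
          obtain ⟨t, ht⟩ := exists_eq_cons_of_mem_sawSet hl' (root o)
          have hel : endpoint l' ∈ l' := by
            rw [ht]; simp [endpoint]
          have hxq : x ∉ q := by
            intro hx
            apply hn.1
            rw [h]
            obtain ⟨p, rfl, -⟩ := exists_eq_append_of_mem_sawSet hq
            rw [glue_concat]
            rcases List.mem_append.1 hx with hx | hx
            · exact List.mem_append_left _ (List.mem_map_of_mem hx)
            · rw [List.mem_singleton.1 hx, append_root]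
              exact List.mem_append_right _ hel
          obtain ⟨t', ht'⟩ := exists_eq_cons_of_mem_sawSet hq (o i)
          rw [← hzq] at ht'
          refine ⟨i, a, b + 1, l', x :: q, by omega, by omega, hl', hj, ⟨?_, ?_, ?_, ?_⟩, ?_⟩
          · rw [ht', List.isChain_cons_cons, ← ht']
            exact ⟨hxy, hq.1⟩
          · exact List.nodup_cons.2 ⟨hxq, hq.2.1⟩
          · rw [← hq.2.2.1, ht', List.getLast?_cons_cons]
          · simp [hq.2.2.2]
          · rw [h]
            obtain ⟨p, rfl, -⟩ := exists_eq_append_of_mem_sawSet hq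
            rw [← List.cons_append, glue_concat, glue_concat]
            rfl

/-- A self-avoiding walk in the free product that starts at the root does not visit the vertices
beyond its endpoint. -/
theorem eq_endpoint_of_prefix {n : ℕ} {l : List (FreeProductVertex o)}
    (hl : l ∈ sawSet (freeProduct G o) (root o) n) {u : FreeProductVertex o} (hu : u ∈ l)
    (hpre : (endpoint l).letters <+: u.letters) : u = endpoint l := by
  induction n using Nat.strong_induction_on generalizing l with
  | _ n ih =>
    rcases exists_glue_of_mem_sawSet hl with ⟨-, rfl⟩ | ⟨j, a, b, l', q, hab, hb, hl', hj, hq, rfl⟩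
    · simpa [endpoint] using hu
    · obtain ⟨x, hx, -, he⟩ := endpoint_glue (l := l') hq hb
      rw [he] at hpre ⊢
      obtain ⟨p, rfl, -, -, hop, -⟩ := exists_eq_append_of_mem_sawSet hq
      rw [glue_concat, List.mem_append] at hu
      have hpre' := hpre
      rw [letters_append_of_ne hj hx] at hpre'
      -- A vertex of the last block is as long a word as the endpoint. A vertex of `l'` would, by
      -- induction, be the endpoint of `l'`, which is too short.
      rcases hu with hu | hu
      · obtain ⟨y, hy, rfl⟩ := List.mem_map.1 hu
        have hyo : y ≠ o j := fun h => hop (h ▸ hy)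
        rw [letters_append_of_ne hj hyo] at hpre'
        exact FreeProductVertex.ext (by
          rw [letters_append_of_ne hj hyo, letters_append_of_ne hj hx]
          exact (hpre'.eq_of_length (by simp)).symm)
      · have h1 : u = endpoint l' :=
          ih a (by omega) hl' hu ((List.prefix_append _ _).trans hpre')
        rw [h1] at hpre'
        have := hpre'.length_le
        simp at this

/-- The new vertices extend the word `endpoint l` by a letter of type `j`, so
`eq_endpoint_of_prefix` shows that `l` has not visited them. -/
theorem glue_mem_sawSet {j : ι} {a b : ℕ} {l : List (FreeProductVertex o)} {q : List (V j)}
    (hl : l ∈ sawSet (freeProduct G o) (root o) a) (hj : (endpoint l).type ≠ some j)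
    (hq : q ∈ sawSet (G j) (o j) b) :
    glue j l q ∈ sawSet (freeProduct G o) (root o) (a + b) := by
  obtain ⟨p, rfl, hc, hn, hop, hlen, hlast⟩ := exists_eq_append_of_mem_sawSet hq
  obtain ⟨t, ht⟩ := exists_eq_cons_of_mem_sawSet hl (root o)
  rw [glue_concat]
  refine ⟨?_, ?_, ?_, ?_⟩
  · rw [List.isChain_append]
    refine ⟨List.isChain_map_of_isChain (append _ j) (fun _ _ => freeProduct_adj_append hj) hc,
      hl.1, ?_⟩
    intro x hx y hy
    rw [ht] at hy
    simp only [List.head?_cons, Option.mem_def, Option.some.injEq] at hy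
    change endpoint l = y at hy
    rw [List.getLast?_map] at hx
    obtain ⟨x, hx', rfl⟩ := Option.mem_map.1 hx
    have := freeProduct_adj_append hj (hlast x hx')
    rw [append_root] at this
    rwa [← hy]
  · rw [List.nodup_append]
    refine ⟨hn.map (append_injective hj), hl.2.1, ?_⟩
    rintro u hu v hv rfl
    obtain ⟨y, hy, rfl⟩ := List.mem_map.1 hu
    have hyo : y ≠ o j := fun h => hop (h ▸ hy)
    have h1 := eq_endpoint_of_prefix hl hv (by
      rw [letters_append_of_ne hj hyo]; exact List.prefix_append _ _)
    have h2 := type_append hj hyo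
    rw [h1] at h2
    exact hj h2
  · rw [List.getLast?_append, hl.2.2.1]; rfl
  · rw [List.length_append, List.length_map, hlen, hl.2.2.2]; omega

/-- As the last blocks are nonempty, deleting the last letter of the common endpoint recovers
`endpoint l = endpoint l'`, so both blocks lie in the same copy. -/
theorem glue_inj {j : ι} {a b a' b' : ℕ} {l l' : List (FreeProductVertex o)} {q q' : List (V j)}
    (hl : l ∈ sawSet (freeProduct G o) (root o) a) (hj : (endpoint l).type ≠ some j)
    (hq : q ∈ sawSet (G j) (o j) b) (hb : b ≠ 0)
    (hl' : l' ∈ sawSet (freeProduct G o) (root o) a') (hj' : (endpoint l').type ≠ some j)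
    (hq' : q' ∈ sawSet (G j) (o j) b') (hb' : b' ≠ 0) (h : glue j l q = glue j l' q') :
    l = l' ∧ q = q' := by
  -- If the cuts differed, the endpoint of the longer initial walk would lie in the other block and
  -- have type `j`.
  have key : ∀ {a : ℕ} {l l' : List (FreeProductVertex o)} {p' s : List (V j)}
      {t : List (FreeProductVertex o)}, l ∈ sawSet (freeProduct G o) (root o) a →
      (endpoint l).type ≠ some j → o j ∉ p' →
      p'.map ((endpoint l).append j) = s.map ((endpoint l).append j) ++ t → l = t ++ l' →
      t = [] := by
    rintro a l l' p' s t hl hj hop hp rfl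
    match t, hp with
    | [], _ => rfl
    | u :: t, hp =>
      exfalso
      have hu : u ∈ p'.map ((endpoint (u :: t ++ l')).append j) := by rw [hp]; simp
      obtain ⟨y, hy, hyu⟩ := List.mem_map.1 hu
      have h2 := type_append hj (show y ≠ o j from fun h => hop (h ▸ hy))
      rw [hyu] at h2
      exact hj h2
  obtain ⟨x, hx, -, he⟩ := endpoint_glue (l := l) hq hb
  obtain ⟨x', hx', -, he'⟩ := endpoint_glue (l := l') hq' hb'
  have hw : endpoint l = endpoint l' :=
    (eq_of_append_eq_append hj hj' hx hx' (by rw [← he, ← he', h])).1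
  obtain ⟨p, rfl, -, -, hop, -⟩ := exists_eq_append_of_mem_sawSet hq
  obtain ⟨p', rfl, -, -, hop', -⟩ := exists_eq_append_of_mem_sawSet hq'
  rw [glue_concat, glue_concat, ← hw] at h
  rcases List.append_eq_append_iff.1 h with ⟨t, h1, h2⟩ | ⟨t, h1, h2⟩
  · obtain rfl := key hl hj hop' h1 h2
    rw [List.append_nil] at h1
    exact ⟨h2, by rw [((append_injective hj).list_map h1)]⟩
  · rw [hw] at h1
    obtain rfl := key hl' hj' hop h1 h2
    rw [List.append_nil] at h1
    exact ⟨h2.symm, by rw [((append_injective hj').list_map h1)]⟩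

/-- The self-avoiding walks in the free product, starting at the root, whose endpoint has
type `t`. -/
def sawSetOfType (G : ∀ i, SimpleGraph (V i)) (o : ∀ i, V i) (t : Option ι) (n : ℕ) :
    Set (List (FreeProductVertex o)) :=
  {l ∈ sawSet (freeProduct G o) (root o) n | (endpoint l).type = t}

/-- The self-avoiding walks in the free product, starting at the root, whose endpoint does not have
type `t`. -/
def sawSetNotOfType (G : ∀ i, SimpleGraph (V i)) (o : ∀ i, V i) (t : Option ι) (n : ℕ) :
    Set (List (FreeProductVertex o)) :=
  {l ∈ sawSet (freeProduct G o) (root o) n | (endpoint l).type ≠ t}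

/-- The self-avoiding walks with at least one step. -/
def sawSetPos {V : Type*} (G : SimpleGraph V) (o : V) (n : ℕ) : Set (List V) :=
  {q ∈ sawSet G o n | n ≠ 0}

/-- The decomposition of a self-avoiding walk in the free product that ends at a vertex of type `j`
into a walk that ends at a vertex of another type and a walk in the factor `j`. -/
theorem exists_equiv_sawSetOfType (G : ∀ i, SimpleGraph (V i)) (o : ∀ i, V i) (j : ι) (n : ℕ) :
    Nonempty ((Σ ab : antidiagonal n, sawSetNotOfType G o (some j) ab.1.1 ×
      sawSetPos (G j) (o j) ab.1.2) ≃ sawSetOfType G o (some j) n) := by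
  refine ⟨Equiv.ofBijective (fun x => ⟨glue j x.2.1.1 x.2.2.1, ?_, ?_⟩) ⟨?_, ?_⟩⟩
  · have := glue_mem_sawSet x.2.1.2.1 x.2.1.2.2 x.2.2.2.1
    rwa [mem_antidiagonal.1 x.1.2] at this
  · obtain ⟨y, hy, -, he⟩ := endpoint_glue (l := x.2.1.1) x.2.2.2.1 x.2.2.2.2
    rw [he]
    exact type_append x.2.1.2.2 hy
  · rintro ⟨⟨⟨a, b⟩, hab⟩, ⟨l, hl⟩, ⟨q, hq⟩⟩ ⟨⟨⟨a', b'⟩, hab'⟩, ⟨l', hl'⟩, ⟨q', hq'⟩⟩ h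
    obtain ⟨rfl, rfl⟩ :=
      glue_inj hl.1 hl.2 hq.1 hq.2 hl'.1 hl'.2 hq'.1 hq'.2 (congrArg Subtype.val h)
    obtain rfl : a = a' := Nat.succ.inj (hl.1.2.2.2.symm.trans hl'.1.2.2.2)
    obtain rfl : b = b' := Nat.succ.inj (hq.1.2.2.2.symm.trans hq'.1.2.2.2)
    rfl
  · rintro ⟨l, hl, ht⟩
    rcases exists_glue_of_mem_sawSet hl with ⟨-, rfl⟩ | ⟨i, a, b, l', q, hab, hb, hl', hj, hq, rfl⟩
    · simp [endpoint, type_root] at ht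
    · obtain ⟨y, hy, -, he⟩ := endpoint_glue (l := l') hq hb
      rw [he, type_append hj hy] at ht
      obtain rfl := Option.some.inj ht
      exact ⟨⟨⟨(a, b), mem_antidiagonal.2 hab⟩, ⟨l', hl', hj⟩, ⟨q, hq, hb⟩⟩, rfl⟩

theorem sawSetOfType_none (n : ℕ) :
    sawSetOfType G o none n = if n = 0 then {[root o]} else ∅ := by
  ext l
  constructor
  · rintro ⟨hl, ht⟩
    rcases exists_glue_of_mem_sawSet hl with
      ⟨rfl, rfl⟩ | ⟨i, a, b, l', q, hab, hb, hl', hj, hq, rfl⟩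
    · simp
    · obtain ⟨y, hy, -, he⟩ := endpoint_glue (l := l') hq hb
      rw [he, type_append hj hy] at ht
      cases ht
  · split_ifs with hn
    · rintro rfl
      subst hn
      exact ⟨by rw [sawSet_zero]; rfl, rfl⟩
    · exact False.elim

theorem sawSet_eq_iUnion (n : ℕ) :
    sawSet (freeProduct G o) (root o) n = ⋃ t, sawSetOfType G o t n := by
  ext l
  simp [sawSetOfType]

/-- The last block is nonempty, so the initial walk is shorter and strong induction applies; local
finiteness of the free product itself is not needed. -/
theorem sawSet_freeProduct_finite [Finite ι] (hG : ∀ i v, ((G i).neighborSet v).Finite) (n : ℕ) :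
    (sawSet (freeProduct G o) (root o) n).Finite := by
  induction n using Nat.strong_induction_on with
  | _ n ih =>
    rw [sawSet_eq_iUnion]
    refine Set.finite_iUnion fun t => ?_
    cases t with
    | none => rw [sawSetOfType_none]; split_ifs <;> simp
    | some j =>
      obtain ⟨e⟩ := exists_equiv_sawSetOfType G o j n
      have : ∀ ab : antidiagonal n, Finite (sawSetNotOfType G o (some j) ab.1.1 ×
          sawSetPos (G j) (o j) ab.1.2) := by
        rintro ⟨⟨a, b⟩, hab⟩
        rw [mem_antidiagonal] at hab
        dsimp only at hab ⊢
        rcases eq_or_ne b 0 with rfl | hb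
        · have : IsEmpty (sawSetPos (G j) (o j) 0) := ⟨fun q => q.2.2 rfl⟩
          infer_instance
        · have : Finite (sawSetNotOfType G o (some j) a) :=
            ((ih a (by omega)).subset (Set.sep_subset _ _)).to_subtype
          have : Finite (sawSetPos (G j) (o j) b) :=
            ((sawSet_finite (hG j) (o j) b).subset (Set.sep_subset _ _)).to_subtype
          infer_instance
      exact Set.finite_coe_iff.1 (Finite.of_equiv _ e)

theorem ncard_sawSetPos {V : Type*} (G : SimpleGraph V) (o : V) (n : ℕ) :
    ((sawSetPos G o n).ncard : ℝ) = sawCoeff G o n := by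
  unfold sawCoeff
  split_ifs with hn
  · simp [sawSetPos, hn]
  · simp [sawSetPos, hn, sawCount_eq_ncard]

theorem ncard_sawSetOfType_some [Finite ι] (hG : ∀ i v, ((G i).neighborSet v).Finite) (j : ι)
    (n : ℕ) : ((sawSetOfType G o (some j) n).ncard : ℝ) = ∑ ab ∈ antidiagonal n,
      ((sawCount (freeProduct G o) (root o) ab.1 : ℝ) - (sawSetOfType G o (some j) ab.1).ncard) *
        sawCoeff (G j) (o j) ab.2 := by
  obtain ⟨e⟩ := exists_equiv_sawSetOfType G o j n
  have hfin := fun n => sawSet_freeProduct_finite (o := o) hG n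
  have hN : ∀ a, Finite (sawSetNotOfType G o (some j) a) := fun a =>
    ((hfin a).subset (Set.sep_subset _ _)).to_subtype
  have hP : ∀ b, Finite (sawSetPos (G j) (o j) b) := fun b =>
    ((sawSet_finite (hG j) (o j) b).subset (Set.sep_subset _ _)).to_subtype
  have hcompl : ∀ a, (sawCount (freeProduct G o) (root o) a : ℝ) -
      (sawSetOfType G o (some j) a).ncard = (sawSetNotOfType G o (some j) a).ncard := by
    intro a
    have hu : sawSet (freeProduct G o) (root o) a =
        sawSetOfType G o (some j) a ∪ sawSetNotOfType G o (some j) a := by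
      ext l
      simp only [sawSetOfType, sawSetNotOfType, Set.mem_union, Set.mem_ofPred_eq]
      tauto
    have hd : Disjoint (sawSetOfType G o (some j) a) (sawSetNotOfType G o (some j) a) :=
      Set.disjoint_left.2 fun l h h' => h'.2 h.2
    rw [sawCount_eq_ncard, hu, Set.ncard_union_eq hd
      ((hfin a).subset (Set.sep_subset _ _)) ((hfin a).subset (Set.sep_subset _ _))]
    push_cast
    ring
  rw [← Nat.card_coe_set_eq, ← Nat.card_congr e, Nat.card_sigma]
  simp only [Nat.card_prod, Nat.card_coe_set_eq]
  rw [Finset.sum_coe_sort (antidiagonal n) fun ab =>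
    (sawSetNotOfType G o (some j) ab.1).ncard * (sawSetPos (G j) (o j) ab.2).ncard]
  push_cast
  simp only [hcompl, ncard_sawSetPos]

theorem sawCount_freeProduct [Fintype ι] (hG : ∀ i v, ((G i).neighborSet v).Finite) (n : ℕ) :
    (sawCount (freeProduct G o) (root o) n : ℝ) =
      (if n = 0 then 1 else 0) + ∑ i, ((sawSetOfType G o (some i) n).ncard : ℝ) := by
  have hfin : ∀ t, (sawSetOfType G o t n).Finite := fun t =>
    (sawSet_freeProduct_finite hG n).subset (Set.sep_subset _ _)
  rw [sawCount_eq_ncard, sawSet_eq_iUnion, Set.ncard_iUnion_of_finite hfin,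
    finsum_eq_sum_of_fintype, Fintype.sum_option]
  · rw [sawSetOfType_none]
    split_ifs <;> simp
  · intro t t' htt
    exact Set.disjoint_left.2 fun l h h' => htt (h.2.symm.trans h'.2)

end FreeProductWalks

/-! ### Power series, the equation for `z_*`, and growth of renewal systems. -/

section Renewal

/-- The value `∑ s n * t ^ n` of a power series with coefficients `s`. -/
noncomputable def powerSum (s : ℕ → ℝ) (t : ℝ) : ℝ := ∑' n, s n * t ^ n

theorem summable_of_bound {s : ℕ → ℝ} (h0 : ∀ n, 0 ≤ s n) {t u B : ℝ} (ht : 0 ≤ t) (htu : t < u)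
    (hB : ∀ n, s n * u ^ n ≤ B) : Summable fun n => s n * t ^ n := by
  have hu : 0 < u := ht.trans_lt htu
  have hg : Summable fun n => B * (t / u) ^ n :=
    (summable_geometric_of_lt_one (by positivity) ((div_lt_one hu).2 htu)).mul_left B
  refine Summable.of_nonneg_of_le (fun n => mul_nonneg (h0 n) (pow_nonneg ht n)) (fun n => ?_) hg
  calc s n * t ^ n = (s n * u ^ n) * (t / u) ^ n := by
        rw [div_pow, mul_assoc, mul_div_cancel₀ _ (pow_pos hu n).ne']
    _ ≤ _ := by gcongr; exact hB n

theorem summable_of_le {s : ℕ → ℝ} (h0 : ∀ n, 0 ≤ s n) {t u : ℝ} (ht : 0 ≤ t) (htu : t ≤ u)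
    (h : Summable fun n => s n * u ^ n) : Summable fun n => s n * t ^ n :=
  Summable.of_nonneg_of_le (fun n => mul_nonneg (h0 n) (pow_nonneg ht n))
    (fun n => mul_le_mul_of_nonneg_left (pow_le_pow_left₀ ht htu n) (h0 n)) h

theorem powerSum_nonneg {s : ℕ → ℝ} (h0 : ∀ n, 0 ≤ s n) {t : ℝ} (ht : 0 ≤ t) :
    0 ≤ powerSum s t := tsum_nonneg fun n => mul_nonneg (h0 n) (pow_nonneg ht n)

theorem powerSum_lt {s : ℕ → ℝ} (h0 : ∀ n, 0 ≤ s n) (h1 : 1 ≤ s 1) {t u : ℝ} (ht : 0 ≤ t)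
    (htu : t < u) (h : Summable fun n => s n * u ^ n) : powerSum s t < powerSum s u :=
  (summable_of_le h0 ht htu.le h).tsum_lt_tsum (i := 1)
    (fun n => mul_le_mul_of_nonneg_left (pow_le_pow_left₀ ht htu.le n) (h0 n))
    (by simpa using mul_lt_mul_of_pos_left htu (one_pos.trans_le h1)) h

theorem le_powerSum {s : ℕ → ℝ} (h0 : ∀ n, 0 ≤ s n) (h1 : 1 ≤ s 1) {t : ℝ} (ht : 0 ≤ t)
    (h : Summable fun n => s n * t ^ n) : t ≤ powerSum s t := by
  have := h.le_tsum 1 (fun n _ => mul_nonneg (h0 n) (pow_nonneg ht n))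
  rw [pow_one] at this
  exact (le_mul_of_one_le_left ht h1).trans this

theorem powerSum_continuousOn {s : ℕ → ℝ} (h0 : ∀ n, 0 ≤ s n) {u : ℝ}
    (h : Summable fun n => s n * u ^ n) : ContinuousOn (powerSum s) (Set.Icc 0 u) := by
  refine continuousOn_tsum (fun n => by fun_prop) h fun n t ht => ?_
  rw [Real.norm_of_nonneg (mul_nonneg (h0 n) (pow_nonneg ht.1 n))]
  exact mul_le_mul_of_nonneg_left (pow_le_pow_left₀ ht.1 ht.2 n) (h0 n)

theorem sum_antidiagonal_eq_sum_range_sub (f : ℕ → ℕ → ℝ) (n : ℕ) :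
    ∑ ab ∈ antidiagonal n, f ab.1 ab.2 = ∑ b ∈ Finset.range (n + 1), f (n - b) b := by
  rw [Finset.Nat.sum_antidiagonal_eq_sum_range_succ f n, ← Finset.sum_range_reflect]
  refine Finset.sum_congr rfl fun b hb => ?_
  rw [Finset.mem_range] at hb
  congr 1; omega

theorem div_one_add_le {a b : ℝ} (ha : 0 ≤ a) (hab : a ≤ b) : a / (1 + a) ≤ b / (1 + b) := by
  rw [div_le_div_iff₀ (by linarith) (by linarith)]; nlinarith

theorem div_one_add_lt {a b : ℝ} (ha : 0 ≤ a) (hab : a < b) : a / (1 + a) < b / (1 + b) := by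
  rw [div_lt_div_iff₀ (by linarith) (by linarith)]; nlinarith

variable {ι : Type*} [Fintype ι] {s : ι → ℕ → ℝ}

/-- The existence of a solution of `∑ M_i / (1 + M_i) = 1`, where the `M_i` are power series with
nonnegative coefficients whose sets of convergence are open. -/
theorem exists_sum_powerSum_eq_one [Nontrivial ι] (h0 : ∀ i n, 0 ≤ s i n) (hs0 : ∀ i, s i 0 = 0)
    (h1 : ∀ i, 1 ≤ s i 1)
    (hpos : ∀ i, ∃ t : ℝ, 0 < t ∧ ∃ B, ∀ n, s i n * t ^ n ≤ B)
    (hopen : ∀ i, ∀ z > 0, (Summable fun n => s i n * z ^ n) →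
      ∃ t > z, ∃ B, ∀ n, s i n * t ^ n ≤ B) :
    ∃ z : ℝ, 0 < z ∧ (∀ i, Summable fun n => s i n * z ^ n) ∧
      ∑ i, powerSum (s i) z / (1 + powerSum (s i) z) = 1 := by
  have glue : ∀ z ≥ (0 : ℝ), (∀ i, ∃ t > z, ∃ B, ∀ n, s i n * t ^ n ≤ B) →
      ∃ u > z, ∀ i, Summable fun n => s i n * u ^ n := by
    intro z hz h
    choose t ht B hB using h
    have hne : (Finset.univ : Finset ι).Nonempty := Finset.univ_nonempty
    have hlt : z < Finset.univ.inf' hne t := (Finset.lt_inf'_iff hne).2 fun i _ => ht i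
    obtain ⟨u, hzu, hut⟩ := exists_between hlt
    exact ⟨u, hzu, fun i => summable_of_bound (h0 i) (hz.le.trans hzu.le)
      (hut.trans_le (Finset.inf'_le _ (Finset.mem_univ i))) (hB i)⟩
  obtain ⟨t₀, ht₀, hst₀⟩ := glue 0 le_rfl hpos
  suffices H : ∃ u : ℝ, 0 < u ∧ (∀ i, Summable fun n => s i n * u ^ n) ∧
      1 ≤ ∑ i, powerSum (s i) u / (1 + powerSum (s i) u) by
    obtain ⟨u, hu, hsu, hfu⟩ := H
    have hcont : ContinuousOn (fun z => ∑ i, powerSum (s i) z / (1 + powerSum (s i) z))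
        (Set.Icc 0 u) := by
      refine continuousOn_finsetSum _ fun i _ => ?_
      have hM := powerSum_continuousOn (h0 i) (hsu i)
      refine hM.div (continuousOn_const.add hM) fun t ht => ?_
      have := powerSum_nonneg (h0 i) ht.1
      positivity
    have hzero : ∑ i, powerSum (s i) 0 / (1 + powerSum (s i) 0) = 0 := by
      refine Finset.sum_eq_zero fun i _ => ?_
      have : powerSum (s i) 0 = 0 := by
        unfold powerSum
        rw [tsum_eq_single 0 (fun n hn => by simp [hn]), hs0]; simp
      simp [this]
    obtain ⟨z, hz, hfz⟩ := intermediate_value_Icc hu.le hcont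
      (show (1 : ℝ) ∈ Set.Icc _ _ from ⟨by simp only [hzero]; norm_num, hfu⟩)
    refine ⟨z, ?_, fun i => summable_of_le (h0 i) hz.1 hz.2 (hsu i), hfz⟩
    rcases hz.1.eq_or_lt with h | h
    · subst h; simp only [hzero] at hfz; norm_num at hfz
    · exact h
  -- Otherwise the sum is below `1` wherever all the series converge.
  by_contra! hcon
  set S : Set ℝ := {t | t₀ ≤ t ∧ ∀ i, Summable fun n => s i n * t ^ n} with hS
  -- Another index contributes at least `t₀ / (1 + t₀)`, which leaves less than `1 / (1 + t₀)` for
  -- `i`; so `M_i < 1 / t₀ ≤ K`.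
  set K : ℝ := (1 + t₀) / t₀ with hK
  have hbound : ∀ t ∈ S, ∀ i, powerSum (s i) t ≤ K := by
    rintro t ⟨htt, hst⟩ i
    obtain ⟨j, hji⟩ := exists_ne i
    have ht : 0 < t := ht₀.trans_le htt
    have hlt := hcon t ht hst
    have hi := powerSum_nonneg (h0 i) ht.le
    have h2 : powerSum (s i) t / (1 + powerSum (s i) t) +
        powerSum (s j) t / (1 + powerSum (s j) t) ≤
        ∑ i, powerSum (s i) t / (1 + powerSum (s i) t) := by
      classical
      rw [← Finset.sum_pair hji.symm (f := fun i => powerSum (s i) t / (1 + powerSum (s i) t))]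
      refine Finset.sum_le_sum_of_subset_of_nonneg (Finset.subset_univ _) fun k _ _ => ?_
      have := powerSum_nonneg (h0 k) ht.le
      positivity
    have h3 : t₀ / (1 + t₀) ≤ powerSum (s j) t / (1 + powerSum (s j) t) :=
      div_one_add_le ht₀.le (htt.trans (le_powerSum (h0 j) (h1 j) ht.le (hst j)))
    have h4 : powerSum (s i) t / (1 + powerSum (s i) t) + t₀ / (1 + t₀) < 1 := by linarith
    rw [div_add_div _ _ (by positivity) (by positivity), div_lt_one (by positivity)] at h4
    rw [hK, le_div_iff₀ ht₀]
    nlinarith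
  have hne : S.Nonempty := ⟨t₀, le_rfl, hst₀⟩
  have hbdd : BddAbove S := by
    refine ⟨K, fun t ht => ?_⟩
    obtain ⟨i⟩ : Nonempty ι := inferInstance
    exact (le_powerSum (h0 i) (h1 i) (ht₀.le.trans ht.1) (ht.2 i)).trans (hbound t ht i)
  have hz₀ : t₀ ≤ sSup S := le_csSup hbdd ⟨le_rfl, hst₀⟩
  have hzpos : 0 < sSup S := ht₀.trans_le hz₀
  -- The bound `K` on each partial sum is a closed condition, so it passes to the supremum.
  have hsum : ∀ i, Summable fun n => s i n * (sSup S) ^ n := by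
    intro i
    refine summable_of_sum_range_le (c := K)
      (fun n => mul_nonneg (h0 i n) (pow_nonneg hzpos.le n)) fun N => ?_
    have hc : Continuous fun t : ℝ => ∑ n ∈ Finset.range N, s i n * t ^ n := by fun_prop
    refine closure_minimal (s := S) (t := {t | ∑ n ∈ Finset.range N, s i n * t ^ n ≤ K}) ?_
      (isClosed_le hc continuous_const) (csSup_mem_closure hne hbdd)
    intro t ht
    exact ((ht.2 i).sum_le_tsum _ fun n _ =>
      mul_nonneg (h0 i n) (pow_nonneg (ht₀.le.trans ht.1) n)).trans (hbound t ht i)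
  obtain ⟨u, hu, hsu⟩ := glue _ hzpos.le fun i => hopen i _ hzpos (hsum i)
  exact hu.not_ge (le_csSup hbdd ⟨hz₀.trans hu.le, hsu⟩)

theorem sum_powerSum_lt [Nonempty ι] (h0 : ∀ i n, 0 ≤ s i n) (h1 : ∀ i, 1 ≤ s i 1) {t u : ℝ}
    (ht : 0 ≤ t) (htu : t < u) (h : ∀ i, Summable fun n => s i n * u ^ n) :
    ∑ i, powerSum (s i) t / (1 + powerSum (s i) t) <
      ∑ i, powerSum (s i) u / (1 + powerSum (s i) u) :=
  Finset.sum_lt_sum_of_nonempty Finset.univ_nonempty fun i _ =>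
    div_one_add_lt (powerSum_nonneg (h0 i) ht) (powerSum_lt (h0 i) (h1 i) ht htu (h i))

/-- The system of renewal equations satisfied by the numbers `σ n` of alternating words of total
length `n`, and the numbers `E i n` of those that end with a letter of type `i`, where there are
`s i n` letters of type `i` and length `n`. -/
structure IsRenewalSystem (s : ι → ℕ → ℝ) (σ : ℕ → ℝ) (E : ι → ℕ → ℝ) : Prop where
  nonneg : ∀ i n, 0 ≤ E i n
  total : ∀ n, σ n = (if n = 0 then 1 else 0) + ∑ i, E i n
  renewal : ∀ i n, E i n = ∑ ab ∈ antidiagonal n, (σ ab.1 - E i ab.1) * s i ab.2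

namespace IsRenewalSystem

variable {σ : ℕ → ℝ} {E : ι → ℕ → ℝ}

theorem sub_eq [DecidableEq ι] (h : IsRenewalSystem s σ E) (i : ι) (n : ℕ) :
    σ n - E i n = (if n = 0 then 1 else 0) + ∑ j ∈ Finset.univ.erase i, E j n := by
  rw [h.total, ← Finset.add_sum_erase _ _ (Finset.mem_univ i)]; ring

theorem sub_nonneg (h : IsRenewalSystem s σ E) (i : ι) (n : ℕ) : 0 ≤ σ n - E i n := by
  classical
  rw [h.sub_eq]
  exact add_nonneg (by split_ifs <;> norm_num) (Finset.sum_nonneg fun j _ => h.nonneg j n)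

theorem zero (h : IsRenewalSystem s σ E) (hs0 : ∀ i, s i 0 = 0) (i : ι) : E i 0 = 0 := by
  rw [h.renewal]; simp [hs0]

/-- Letters of length `1` of two different types can be alternated for ever. This starts the
induction in `lower_bound`. -/
theorem one_le [Nontrivial ι] (h : IsRenewalSystem s σ E) (h0 : ∀ i n, 0 ≤ s i n)
    (hs0 : ∀ i, s i 0 = 0) (h1 : ∀ i, 1 ≤ s i 1) (i : ι) {n : ℕ} (hn : n ≠ 0) : 1 ≤ E i n := by
  classical
  have step : ∀ i n, σ n - E i n ≤ E i (n + 1) := by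
    intro i n
    rw [h.renewal i (n + 1)]
    refine le_trans ?_ (Finset.single_le_sum
      (f := fun ab : ℕ × ℕ => (σ ab.1 - E i ab.1) * s i ab.2)
      (fun ab _ => mul_nonneg (h.sub_nonneg i _) (h0 i _))
      (show (n, 1) ∈ antidiagonal (n + 1) by simp))
    exact le_mul_of_one_le_right (h.sub_nonneg i n) (h1 i)
  obtain ⟨n, rfl⟩ := Nat.exists_eq_succ_of_ne_zero hn
  induction n generalizing i with
  | zero =>
    refine le_trans ?_ (step i 0)
    rw [h.sub_eq]
    simp [h.zero hs0]
  | succ n ih =>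
    obtain ⟨j, hj⟩ := exists_ne i
    refine le_trans ?_ (step i (n + 1))
    rw [h.sub_eq]
    simp only [Nat.succ_ne_zero, if_false, zero_add]
    exact (ih j (by simp)).trans (Finset.single_le_sum (f := fun j => E j (n + 1))
      (fun k _ => h.nonneg k _) (Finset.mem_erase.2 ⟨hj, Finset.mem_univ j⟩))

/-- The bound `E i n * z ^ n ≤ C * v i` reproduces itself: the other types contribute `C * (1 - v
i)`, and `(1 - v i) * M i = v i`. -/
theorem upper_bound (h : IsRenewalSystem s σ E) (h0 : ∀ i n, 0 ≤ s i n) (hs0 : ∀ i, s i 0 = 0)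
    {z : ℝ} (hz : 0 < z) (hs : ∀ i, Summable fun n => s i n * z ^ n)
    (hz1 : ∑ i, powerSum (s i) z / (1 + powerSum (s i) z) = 1) :
    ∃ C : ℝ, 0 < C ∧ ∀ n, n ≠ 0 → σ n * z ^ n ≤ C := by
  classical
  set M : ι → ℝ := fun i => powerSum (s i) z with hM
  have hM0 : ∀ i, 0 ≤ M i := fun i => powerSum_nonneg (h0 i) hz.le
  set v : ι → ℝ := fun i => M i / (1 + M i) with hv
  have hv1 : ∑ i, v i = 1 := hz1
  have h1v : ∀ i, 1 - v i = 1 / (1 + M i) := fun i => by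
    have := hM0 i
    simp only [hv]; field_simp; ring
  -- The empty word contributes `1`, which must be at most `C * (1 - v i) = C / (1 + M i)`.
  set C : ℝ := 1 + ∑ i, M i with hC
  have hC0 : 0 < C := by have := Finset.sum_nonneg fun i (_ : i ∈ Finset.univ) => hM0 i; positivity
  have hMC : ∀ i, 1 + M i ≤ C := fun i => by
    have := Finset.single_le_sum (fun i _ => hM0 i) (Finset.mem_univ i)
    simpa [hC] using this
  have key : ∀ n i, E i n * z ^ n ≤ C * v i := by
    intro n
    induction n using Nat.strong_induction_on with
    | _ n ih =>
      intro i
      have hsub : ∀ a < n, (σ a - E i a) * z ^ a ≤ C * (1 - v i) := by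
        intro a ha
        rw [h.sub_eq]
        rcases eq_or_ne a 0 with rfl | ha0
        · have : 0 < 1 + M i := by have := hM0 i; positivity
          simp only [h.zero hs0, if_true, Finset.sum_const_zero, add_zero, pow_zero, mul_one]
          rw [h1v, mul_one_div, le_div_iff₀ this, one_mul]
          exact hMC i
        · rw [if_neg ha0, zero_add, Finset.sum_mul]
          calc _ ≤ ∑ j ∈ Finset.univ.erase i, C * v j := Finset.sum_le_sum fun j _ => ih a ha j
            _ = C * (1 - v i) := by
              rw [← Finset.mul_sum, ← hv1, ← Finset.add_sum_erase _ _ (Finset.mem_univ i)]; ring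
      have h1 : ∑ ab ∈ antidiagonal n, s i ab.2 * z ^ ab.2 ≤ M i := by
        rw [sum_antidiagonal_eq_sum_range_sub fun a b => s i b * z ^ b]
        exact (hs i).sum_le_tsum _ fun n _ => mul_nonneg (h0 i n) (pow_nonneg hz.le n)
      rw [h.renewal, Finset.sum_mul]
      calc ∑ ab ∈ antidiagonal n, (σ ab.1 - E i ab.1) * s i ab.2 * z ^ n
          ≤ ∑ ab ∈ antidiagonal n, C * (1 - v i) * (s i ab.2 * z ^ ab.2) := by
            refine Finset.sum_le_sum fun ab hab => ?_
            rw [mem_antidiagonal] at hab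
            rcases eq_or_ne ab.2 0 with hb | hb
            · simp [hb, hs0]
            · rw [← hab, pow_add]
              calc _ = ((σ ab.1 - E i ab.1) * z ^ ab.1) * (s i ab.2 * z ^ ab.2) := by ring
                _ ≤ _ := mul_le_mul_of_nonneg_right (hsub _ (by omega))
                  (mul_nonneg (h0 i _) (pow_nonneg hz.le _))
        _ ≤ C * (1 - v i) * M i := by
            rw [← Finset.mul_sum]
            refine mul_le_mul_of_nonneg_left h1 (mul_nonneg hC0.le ?_)
            rw [h1v]; have := hM0 i; positivity
        _ = C * v i := by rw [h1v]; simp only [hv]; ring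
  refine ⟨C, hC0, fun n hn => ?_⟩
  rw [h.total, if_neg hn, zero_add, Finset.sum_mul]
  calc _ ≤ ∑ i, C * v i := Finset.sum_le_sum fun i _ => key n i
    _ = C := by rw [← Finset.mul_sum, hv1, mul_one]

/-- The induction of `upper_bound` reversed. At `t > z` the series may diverge, so they are cut off
at `N`, chosen so that the weights still sum to at least `1`. -/
theorem lower_bound [Nontrivial ι] (h : IsRenewalSystem s σ E) (h0 : ∀ i n, 0 ≤ s i n)
    (hs0 : ∀ i, s i 0 = 0) (h1 : ∀ i, 1 ≤ s i 1) {z : ℝ} (hz : 0 < z)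
    (hs : ∀ i, Summable fun n => s i n * z ^ n)
    (hz1 : ∑ i, powerSum (s i) z / (1 + powerSum (s i) z) = 1) {t : ℝ} (ht : z < t) :
    ∃ c : ℝ, 0 < c ∧ ∀ n, n ≠ 0 → c ≤ σ n * t ^ n := by
  classical
  have ht0 : 0 < t := hz.trans ht
  set P : ι → ℕ → ℝ := fun i N => ∑ b ∈ Finset.range N, s i b * t ^ b with hP
  have hP0 : ∀ i N, 0 ≤ P i N := fun i N =>
    Finset.sum_nonneg fun b _ => mul_nonneg (h0 i b) (pow_nonneg ht0.le b)
  obtain ⟨N, hN⟩ : ∃ N, 1 ≤ ∑ i, P i N / (1 + P i N) := by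
    have hM : ∀ i, 0 < powerSum (s i) z := fun i =>
      hz.trans_le (le_powerSum (h0 i) (h1 i) hz.le (hs i))
    have hev : ∀ i, ∀ᶠ N in atTop, powerSum (s i) z ≤ P i N := by
      intro i
      have hlim : Tendsto (fun N => (t / z) * ∑ b ∈ Finset.range N, s i b * z ^ b) atTop
          (𝓝 ((t / z) * powerSum (s i) z)) := ((hs i).hasSum.tendsto_sum_nat).const_mul _
      -- With no constant term, passing from `z` to `t` multiplies each term by at least `t / z >
      -- 1`.
      have hlt : powerSum (s i) z < (t / z) * powerSum (s i) z :=
        lt_mul_of_one_lt_left (hM i) ((one_lt_div hz).2 ht)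
      filter_upwards [hlim.eventually_const_lt hlt] with N hN
      refine hN.le.trans ?_
      simp only [hP]
      rw [Finset.mul_sum]
      refine Finset.sum_le_sum fun b _ => ?_
      rcases b with _ | b
      · simp [hs0]
      · have h2 : t / z * z ^ (b + 1) ≤ t ^ (b + 1) := by
          rw [pow_succ', ← mul_assoc, div_mul_cancel₀ _ hz.ne', pow_succ']
          gcongr
        calc t / z * (s i (b + 1) * z ^ (b + 1)) = s i (b + 1) * (t / z * z ^ (b + 1)) := by ring
          _ ≤ _ := mul_le_mul_of_nonneg_left h2 (h0 i _)
    obtain ⟨N, hN⟩ := (eventually_all.2 hev).exists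
    exact ⟨N, hz1.symm.le.trans
      (Finset.sum_le_sum fun i _ => div_one_add_le (hM i).le (hN i))⟩
  set v : ι → ℝ := fun i => P i N / (1 + P i N) with hv
  have hv0 : ∀ i, 0 ≤ v i := fun i => div_nonneg (hP0 i N) (by have := hP0 i N; positivity)
  have hv1 : ∀ i, v i ≤ 1 := fun i => by
    have := hP0 i N
    simp only [hv]
    rw [div_le_one (by positivity)]; linarith
  -- A lower bound for `t ^ n` over all `n ≤ N`, whether `t` is above or below `1`.
  set c : ℝ := min 1 (t ^ N) with hc
  have hc0 : 0 < c := lt_min one_pos (pow_pos ht0 N)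
  have hct : ∀ n ≤ N, c ≤ t ^ n := by
    intro n hn
    rcases le_total 1 t with h | h
    · exact (min_le_left _ _).trans (one_le_pow₀ h)
    · exact (min_le_right _ _).trans (pow_le_pow_of_le_one ht0.le h hn)
  have key : ∀ n ≠ 0, ∀ i, c * v i ≤ E i n * t ^ n := by
    intro n
    induction n using Nat.strong_induction_on with
    | _ n ih =>
      intro hn i
      rcases le_or_gt n N with hnN | hnN
      · calc c * v i ≤ c * 1 := mul_le_mul_of_nonneg_left (hv1 i) hc0.le
          _ = 1 * c := by ring
          _ ≤ E i n * t ^ n := mul_le_mul (h.one_le h0 hs0 h1 i hn) (hct n hnN) hc0.le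
            (h.nonneg i n)
      -- For `n > N` and `b < N` the index `a = n - b` is never `0`, so the empty word does not
      -- occur.
      have hsub : ∀ a < n, a ≠ 0 → c * (1 - v i) ≤ (σ a - E i a) * t ^ a := by
        intro a ha ha0
        rw [h.sub_eq, if_neg ha0, zero_add, Finset.sum_mul]
        calc c * (1 - v i) ≤ c * ∑ j ∈ Finset.univ.erase i, v j := by
              refine mul_le_mul_of_nonneg_left ?_ hc0.le
              have := Finset.add_sum_erase _ v (Finset.mem_univ i)
              have hN' : 1 ≤ ∑ i, v i := hN
              linarith
          _ = ∑ j ∈ Finset.univ.erase i, c * v j := Finset.mul_sum _ _ _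
          _ ≤ _ := Finset.sum_le_sum fun j _ => ih a ha ha0 j
      rw [h.renewal, Finset.sum_mul]
      calc c * v i = c * (1 - v i) * P i N := by
            have : 0 < 1 + P i N := by have := hP0 i N; positivity
            simp only [hv]; field_simp; ring
        _ = ∑ b ∈ Finset.range N, c * (1 - v i) * (s i b * t ^ b) := Finset.mul_sum _ _ _
        _ ≤ ∑ b ∈ Finset.range N, (σ (n - b) - E i (n - b)) * s i b * t ^ n := by
            refine Finset.sum_le_sum fun b hb => ?_
            rw [Finset.mem_range] at hb
            rcases eq_or_ne b 0 with rfl | hb0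
            · simp [hs0]
            have e : t ^ n = t ^ (n - b) * t ^ b := by rw [← pow_add]; congr 1; omega
            rw [e]
            calc _ ≤ ((σ (n - b) - E i (n - b)) * t ^ (n - b)) * (s i b * t ^ b) :=
                  mul_le_mul_of_nonneg_right (hsub _ (by omega) (by omega))
                    (mul_nonneg (h0 i b) (pow_nonneg ht0.le b))
              _ = _ := by ring
        _ ≤ ∑ b ∈ Finset.range (n + 1), (σ (n - b) - E i (n - b)) * s i b * t ^ n := by
            refine Finset.sum_le_sum_of_subset_of_nonneg
              (Finset.range_subset_range.2 (by omega)) fun b _ _ => ?_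
            exact mul_nonneg (mul_nonneg (h.sub_nonneg i _) (h0 i b)) (pow_nonneg ht0.le n)
        _ = _ := (sum_antidiagonal_eq_sum_range_sub
            (fun a b => (σ a - E i a) * s i b * t ^ n) n).symm
  refine ⟨c, hc0, fun n hn => ?_⟩
  rw [h.total, if_neg hn, zero_add, Finset.sum_mul]
  calc c ≤ c * ∑ i, v i := le_mul_of_one_le_right hc0.le hN
    _ = ∑ i, c * v i := Finset.mul_sum _ _ _
    _ ≤ _ := Finset.sum_le_sum fun i _ => key n hn i

end IsRenewalSystem

theorem tendsto_rpow_one_div_of_pos {C : ℝ} (hC : 0 < C) :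
    Tendsto (fun n : ℕ => C ^ (1 / (n : ℝ))) atTop (𝓝 1) := by
  have h : Tendsto (fun n : ℕ => 1 / (n : ℝ)) atTop (𝓝 0) := tendsto_one_div_atTop_nhds_zero_nat
  have h2 := (Real.continuousAt_const_rpow hC.ne' (b := 0)).tendsto.comp h
  rwa [Real.rpow_zero] at h2

/-- Two-sided exponential bounds determine the exponential growth rate of a sequence. -/
theorem tendsto_rpow_one_div_of_bounds {σ : ℕ → ℝ} (h0 : ∀ n, 0 ≤ σ n) {z : ℝ} (hz : 0 < z)
    (hup : ∃ C : ℝ, 0 < C ∧ ∀ n, n ≠ 0 → σ n * z ^ n ≤ C)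
    (hlow : ∀ t > z, ∃ c : ℝ, 0 < c ∧ ∀ n, n ≠ 0 → c ≤ σ n * t ^ n) :
    Tendsto (fun n : ℕ => σ n ^ (1 / (n : ℝ))) atTop (𝓝 (1 / z)) := by
  have hroot : ∀ {t : ℝ}, 0 < t → ∀ n : ℕ, n ≠ 0 →
      (σ n * t ^ n) ^ (1 / (n : ℝ)) = σ n ^ (1 / (n : ℝ)) * t := by
    intro t ht n hn
    rw [Real.mul_rpow (h0 n) (pow_nonneg ht.le n), one_div, Real.pow_rpow_inv_natCast ht.le hn]
  rw [tendsto_order]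
  constructor
  · intro a ha
    rcases le_or_gt a 0 with ha0 | ha0
    · obtain ⟨c, hc, hcn⟩ := hlow (z + 1) (by linarith)
      filter_upwards [eventually_ne_atTop 0] with n hn
      have : 0 < σ n := by
        by_contra! hle
        have := hcn n hn
        have h2 : 0 < (z + 1) ^ n := by positivity
        nlinarith
      exact ha0.trans_lt (Real.rpow_pos_of_pos this _)
    · have hza : z < 1 / a := by rwa [lt_div_iff₀ ha0, mul_comm, ← lt_div_iff₀ hz]
      -- Now `a * t < 1`, while `c ^ (1 / n)` tends to `1` and bounds `σ n ^ (1 / n) * t` from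
      -- below.
      obtain ⟨t, hzt, hta⟩ := exists_between hza
      have ht0 : 0 < t := hz.trans hzt
      obtain ⟨c, hc, hcn⟩ := hlow t hzt
      have hat : a * t < 1 := by rwa [lt_div_iff₀ ha0, mul_comm] at hta
      filter_upwards [(tendsto_rpow_one_div_of_pos hc).eventually_const_lt hat,
        eventually_ne_atTop 0] with n hn hn0
      have h2 := Real.rpow_le_rpow hc.le (hcn n hn0) (by positivity : 0 ≤ 1 / (n : ℝ))
      rw [hroot ht0 n hn0] at h2
      exact lt_of_mul_lt_mul_right (hn.trans_le h2) ht0.le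
  · intro a ha
    obtain ⟨C, hC, hCn⟩ := hup
    have haz : 1 < a * z := (div_lt_iff₀ hz).1 ha
    filter_upwards [(tendsto_rpow_one_div_of_pos hC).eventually_lt_const haz,
      eventually_ne_atTop 0] with n hn hn0
    have h2 := Real.rpow_le_rpow (mul_nonneg (h0 n) (pow_nonneg hz.le n)) (hCn n hn0)
      (by positivity : 0 ≤ 1 / (n : ℝ))
    rw [hroot hz n hn0] at h2
    exact lt_of_mul_lt_mul_right (h2.trans_lt hn) hz.le

end Renewal

/-! ### The coefficients of `M_i`, and the main theorem. -/

section ConnectiveConstant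

variable {V : Type*} {G : SimpleGraph V}

theorem sawCoeff_nonneg (G : SimpleGraph V) (o : V) (n : ℕ) : 0 ≤ sawCoeff G o n := by
  unfold sawCoeff; split_ifs <;> positivity

theorem sawCoeff_le (G : SimpleGraph V) (o : V) (n : ℕ) : sawCoeff G o n ≤ sawCount G o n := by
  unfold sawCoeff; split_ifs <;> simp

theorem one_le_sawCoeff_one [Nontrivial V] (hconn : G.Connected)
    (hG : ∀ v, (G.neighborSet v).Finite) (o : V) : 1 ≤ sawCoeff G o 1 := by
  rw [sawCoeff, if_neg one_ne_zero, sawCount_eq_ncard, Nat.one_le_cast, Nat.one_le_iff_ne_zero,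
    ← Nat.pos_iff_ne_zero, Set.ncard_pos (sawSet_finite hG o 1)]
  exact sawSet_nonempty_one hconn o

theorem summable_sawCoeff_iff {o : V} {z : ℝ} :
    (Summable fun n => sawCoeff G o n * z ^ n) ↔
      Summable fun n => (sawCount G o n : ℝ) * z ^ n := by
  rw [← summable_nat_add_iff 1,
    ← summable_nat_add_iff (f := fun n => (sawCount G o n : ℝ) * z ^ n) 1]
  simp [sawCoeff]

theorem sawCoeff_bound {o : V} {t : ℝ} (ht : 0 < t)
    (h : ∃ B : ℝ, ∀ n, (sawCount G o n : ℝ) * t ^ n ≤ B) :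
    ∃ B : ℝ, ∀ n, sawCoeff G o n * t ^ n ≤ B := by
  obtain ⟨B, hB⟩ := h
  exact ⟨B, fun n => (mul_le_mul_of_nonneg_right (sawCoeff_le G o n) (by positivity)).trans (hB n)⟩

theorem le_sawRadius_of_bound {o : V} {t B : ℝ} (ht : 0 ≤ t)
    (hB : ∀ n, sawCoeff G o n * t ^ n ≤ B) : ENNReal.ofReal t ≤ sawRadius G o := by
  refine FormalMultilinearSeries.le_radius_of_bound _ B fun n => ?_
  rw [FormalMultilinearSeries.ofScalars_norm, Real.norm_of_nonneg (sawCoeff_nonneg G o n),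
    Real.coe_toNNReal t ht]
  exact hB n

end ConnectiveConstant

theorem isRenewalSystem_freeProduct {ι : Type*} [Fintype ι] {V : ι → Type*}
    (G : ∀ i, SimpleGraph (V i)) (o : ∀ i, V i) (hG : ∀ i v, ((G i).neighborSet v).Finite) :
    IsRenewalSystem (fun i => sawCoeff (G i) (o i))
      (fun n => (sawCount (freeProduct G o) (FreeProductVertex.root o) n : ℝ))
      (fun i n => ((sawSetOfType G o (some i) n).ncard : ℝ)) where
  nonneg _ _ := by positivity
  total n := sawCount_freeProduct hG n
  renewal i n := ncard_sawSetOfType_some hG i n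

theorem theorem3p2 {r : ℕ} (hr : 2 ≤ r) (V : Fin r → Type*) (G : ∀ i, SimpleGraph (V i))
    (o : ∀ i, V i)
    (hnontrivial : ∀ i, Nontrivial (V i))
    (hconn : ∀ i, (G i).Connected)
    (hlocfin : ∀ i v, ((G i).neighborSet v).Finite)
    (hqt : ∀ i, IsQuasiTransitive (G i)) :
    ∃ z : ℝ,
      IsLeast {t : ℝ | 0 < t ∧ (∀ i, Summable fun n : ℕ => sawCoeff (G i) (o i) n * t ^ n) ∧
        ∑ i, sawGF (G i) (o i) t / (1 + sawGF (G i) (o i) t) = 1} z ∧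
      (∀ i, ENNReal.ofReal z < sawRadius (G i) (o i)) ∧
      IsConnectiveConstant (freeProduct G o) (FreeProductVertex.root o) (1 / z) := by

  have : Nontrivial (Fin r) := Fin.nontrivial_iff_two_le.2 hr
  have h0 : ∀ i n, 0 ≤ sawCoeff (G i) (o i) n := fun i n => sawCoeff_nonneg _ _ n
  have hs0 : ∀ i, sawCoeff (G i) (o i) 0 = 0 := fun i => if_pos rfl
  have h1 : ∀ i, 1 ≤ sawCoeff (G i) (o i) 1 := fun i =>
    one_le_sawCoeff_one (hconn i) (hlocfin i) (o i)
  have hopen : ∀ i, ∀ z > 0, (Summable fun n => sawCoeff (G i) (o i) n * z ^ n) →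
      ∃ t > z, ∃ B, ∀ n, sawCoeff (G i) (o i) n * t ^ n ≤ B := by
    intro i z hz hs
    obtain ⟨t, hzt, hB⟩ :=
      sawCount_bound_of_summable (hlocfin i) (hconn i) (hqt i) hz (summable_sawCoeff_iff.1 hs)
    exact ⟨t, hzt, sawCoeff_bound (hz.trans hzt) hB⟩
  have hpos : ∀ i, ∃ t : ℝ, 0 < t ∧ ∃ B, ∀ n, sawCoeff (G i) (o i) n * t ^ n ≤ B := by
    intro i
    obtain ⟨t, ht, hB⟩ := sawCount_bound_near_zero (hlocfin i) (hqt i) (o i)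
    exact ⟨t, ht, sawCoeff_bound ht hB⟩
  obtain ⟨z, hz, hs, hz1⟩ := exists_sum_powerSum_eq_one h0 hs0 h1 hpos hopen
  refine ⟨z, ⟨⟨hz, hs, hz1⟩, ?_⟩, ?_, ?_⟩
  -- The sum is strictly increasing up to `z`, so no smaller solution exists.
  · rintro t ⟨ht, -, ht1⟩
    by_contra! htz
    have hlt := sum_powerSum_lt h0 h1 ht.le htz hs
    rw [hz1] at hlt
    exact hlt.ne ht1
  -- Openness of the set of convergence makes the inequality with the radius strict.
  · intro i
    obtain ⟨t, hzt, B, hB⟩ := hopen i z hz (hs i)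
    have ht : 0 < t := hz.trans hzt
    exact ((ENNReal.ofReal_lt_ofReal_iff ht).2 hzt).trans_le (le_sawRadius_of_bound ht.le hB)
  · have hR := isRenewalSystem_freeProduct G o hlocfin
    exact tendsto_rpow_one_div_of_bounds (fun _ => Nat.cast_nonneg _) hz
      (hR.upper_bound h0 hs0 hz hs hz1) fun t ht => hR.lower_bound h0 hs0 h1 hz hs hz1 ht
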